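/- Let $F$ be a field of characteristic different from $2$, and let $A$ be a Novikov algebra over $F$, that is, a (not necessarily associative or unital) $F$-algebra satisfying $(x,y,z)=(y,x,z)$ and $(xy)z=(xz)y$ for all $x,y,z\in A$, where $(x,y,z)=(xy)z-x(yz)$. Put $A^{(0)_L}=A$ and let $A^{(n+1)_L}$ be the subspace spanned by all commutators $xy-yx$ with $x,y\in A^{(n)_L}$; assume that $A$ is Lie-solvable, i.e. $A^{(n)_L}=0$ for some $n\ge 0$. An ideal means a two-sided ideal that is an $F$-subspace, and an ideal $I$ is trivial if $xy=0$ for all $x,y\in I$. Let $\mathcal B_0(A)=0$; for every ordinal $\alpha$ let $\mathcal B_{\alpha+1}(A)$ be the preimage in $A$ of the sum of all trivial ideals of $A/\mathcal B_\alpha(A)$; and let $\mathcal B_\alpha(A)=\bigcup_{\beta<\alpha}\mathcal B_\beta(A)$ for limit ordinals $\alpha$. The Baer radical of $A$ is $\mathcal B(A)=\mathcal B_\delta(A)$, where $\delta$ is any ordinal whose cardinality is greater than $|A|$. Then $$\mathcal B(A)=\bigcap\{\,I \;:\; I \text{ is an ideal of } A \text{ and } A/I \text{ is an integral domain}\,\},$$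 where an integral domain is an associative and commutative (not necessarily unital) algebra without nonzero zero divisors. -/

import Mathlib

universe u v

/-- A (not necessarily unital, not necessarily associative) algebra is a *Novikov algebra* if it
satisfies `(x, y, z) = (y, x, z)`, where `(x, y, z) = (x y) z - x (y z)`,
and `(x y) z = (x z) y`. -/
class IsNovikov (A : Type u) [NonUnitalNonAssocRing A] : Prop where
  associator_left_symm : ∀ x y z : A, associator x y z = associator y x z
  mul_right_comm : ∀ x y z : A, (x * y) * z = (x * z) * y

/-- A two-sided ideal of a nonassociative `F`-algebra: a subspace closed under left and right
multiplication by elements of the algebra. -/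
structure AlgIdeal (F : Type v) (A : Type u) [Field F] [NonUnitalNonAssocRing A] [Module F A]
    extends Submodule F A where
  mul_mem_left' : ∀ a x : A, x ∈ carrier → a * x ∈ carrier
  mul_mem_right' : ∀ a x : A, x ∈ carrier → x * a ∈ carrier

namespace AlgIdeal

variable {F : Type v} {A : Type u} [Field F] [NonUnitalNonAssocRing A] [Module F A]

instance : SetLike (AlgIdeal F A) A where
  coe I := I.carrier
  coe_injective := by
    rintro ⟨I, _, _⟩ ⟨J, _, _⟩ h
    have : I = J := SetLike.coe_injective h
    subst this
    rfl

instance : PartialOrder (AlgIdeal F A) := .ofSetLike (AlgIdeal F A) A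

theorem mem_toSubmodule (I : AlgIdeal F A) (x : A) : x ∈ I.toSubmodule ↔ x ∈ I := Iff.rfl

theorem mul_mem_left (I : AlgIdeal F A) (a : A) {x : A} (hx : x ∈ I.toSubmodule) :
    a * x ∈ I.toSubmodule := I.mul_mem_left' a x hx

theorem mul_mem_right (I : AlgIdeal F A) (a : A) {x : A} (hx : x ∈ I.toSubmodule) :
    x * a ∈ I.toSubmodule := I.mul_mem_right' a x hx

/-- The zero ideal. -/
def zero (F : Type v) (A : Type u) [Field F] [NonUnitalNonAssocRing A] [Module F A] :
    AlgIdeal F A where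
  toSubmodule := ⊥
  mul_mem_left' a x hx := by
    have hx : x = 0 := hx
    subst hx
    exact mul_zero a
  mul_mem_right' a x hx := by
    have hx : x = 0 := hx
    subst hx
    exact zero_mul a

/-- The quotient algebra `A / I`. -/
def Quotient (I : AlgIdeal F A) : Type u := A ⧸ I.toSubmodule

instance (I : AlgIdeal F A) : AddCommGroup I.Quotient :=
  inferInstanceAs (AddCommGroup (A ⧸ I.toSubmodule))

instance (I : AlgIdeal F A) : Module F I.Quotient :=
  inferInstanceAs (Module F (A ⧸ I.toSubmodule))

/-- The canonical projection `A → A / I`, as a linear map. -/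
def proj (I : AlgIdeal F A) : A →ₗ[F] I.Quotient := I.toSubmodule.mkQ

theorem proj_surjective (I : AlgIdeal F A) : Function.Surjective I.proj :=
  Submodule.mkQ_surjective _

theorem proj_eq_zero (I : AlgIdeal F A) (x : A) : I.proj x = 0 ↔ x ∈ I :=
  Submodule.Quotient.mk_eq_zero _

/-- Multiplication of cosets: `(x + I) (y + I) = x y + I`. -/
instance (I : AlgIdeal F A) : Mul I.Quotient where
  mul := Quotient.map₂ (· * ·) (by
    intro a b hab c d hcd
    have hab := (Submodule.quotientRel_def _).1 hab
    have hcd := (Submodule.quotientRel_def _).1 hcd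
    refine (Submodule.quotientRel_def _).2 ?_
    have e : a * c - b * d = (a - b) * c + b * (c - d) := by
      rw [sub_mul, mul_sub]
      abel
    change a * c - b * d ∈ _
    rw [e]
    exact add_mem (I.mul_mem_right c hab) (I.mul_mem_left b hcd))

theorem proj_mul (I : AlgIdeal F A) (x y : A) : I.proj (x * y) = I.proj x * I.proj y := rfl

instance (I : AlgIdeal F A) : NonUnitalNonAssocRing I.Quotient where
  __ := (inferInstance : AddCommGroup I.Quotient)
  __ := (inferInstance : Mul I.Quotient)
  left_distrib a b c := by
    obtain ⟨a, rfl⟩ := I.proj_surjective a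
    obtain ⟨b, rfl⟩ := I.proj_surjective b
    obtain ⟨c, rfl⟩ := I.proj_surjective c
    simp only [← map_add, ← proj_mul, mul_add]
  right_distrib a b c := by
    obtain ⟨a, rfl⟩ := I.proj_surjective a
    obtain ⟨b, rfl⟩ := I.proj_surjective b
    obtain ⟨c, rfl⟩ := I.proj_surjective c
    simp only [← map_add, ← proj_mul, add_mul]
  zero_mul a := by
    obtain ⟨a, rfl⟩ := I.proj_surjective a
    rw [← map_zero I.proj, ← proj_mul, zero_mul]
  mul_zero a := by
    obtain ⟨a, rfl⟩ := I.proj_surjective a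
    rw [← map_zero I.proj, ← proj_mul, mul_zero]

instance (I : AlgIdeal F A) [IsScalarTower F A A] : IsScalarTower F I.Quotient I.Quotient where
  smul_assoc c x y := by
    obtain ⟨x, rfl⟩ := I.proj_surjective x
    obtain ⟨y, rfl⟩ := I.proj_surjective y
    simp only [smul_eq_mul, ← map_smul, ← proj_mul, smul_mul_assoc]

instance (I : AlgIdeal F A) [SMulCommClass F A A] : SMulCommClass F I.Quotient I.Quotient where
  smul_comm c x y := by
    obtain ⟨x, rfl⟩ := I.proj_surjective x
    obtain ⟨y, rfl⟩ := I.proj_surjective y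
    simp only [smul_eq_mul, ← map_smul, ← proj_mul, mul_smul_comm]

/-- The preimage in `A` of an ideal of `A / I`. -/
def preimage (I : AlgIdeal F A) (J : AlgIdeal F I.Quotient) : AlgIdeal F A where
  toSubmodule := J.toSubmodule.comap I.proj
  mul_mem_left' a _ hx := J.mul_mem_left (I.proj a) hx
  mul_mem_right' a _ hx := J.mul_mem_right (I.proj a) hx

theorem mem_preimage (I : AlgIdeal F A) (J : AlgIdeal F I.Quotient) (x : A) :
    x ∈ I.preimage J ↔ I.proj x ∈ J := Iff.rfl

variable [IsScalarTower F A A] [SMulCommClass F A A]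

/-- The sum of a set of ideals. -/
def sum (S : Set (AlgIdeal F A)) : AlgIdeal F A where
  toSubmodule := ⨆ I ∈ S, I.toSubmodule
  mul_mem_left' a x hx := by
    have h : (⨆ I ∈ S, I.toSubmodule) ≤ (⨆ I ∈ S, I.toSubmodule).comap (LinearMap.mulLeft F a) :=
      iSup₂_le fun I hI y hy =>
        (le_iSup₂ (f := fun (I : AlgIdeal F A) (_ : I ∈ S) => I.toSubmodule) I hI)
          (I.mul_mem_left a hy)
    exact h hx
  mul_mem_right' a x hx := by
    have h : (⨆ I ∈ S, I.toSubmodule) ≤ (⨆ I ∈ S, I.toSubmodule).comap (LinearMap.mulRight F a) :=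
      iSup₂_le fun I hI y hy =>
        (le_iSup₂ (f := fun (I : AlgIdeal F A) (_ : I ∈ S) => I.toSubmodule) I hI)
          (I.mul_mem_right a hy)
    exact h hx

theorem le_sum {S : Set (AlgIdeal F A)} {I : AlgIdeal F A} (hI : I ∈ S) : I ≤ sum S := fun _ hx =>
  (le_iSup₂ (f := fun (I : AlgIdeal F A) (_ : I ∈ S) => I.toSubmodule) I hI) hx

/-- An ideal `I` is *trivial* if it has zero multiplication, `I² = 0`. -/
def IsTrivial {F : Type v} {A : Type u} [Field F] [NonUnitalNonAssocRing A] [Module F A]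
    (I : AlgIdeal F A) : Prop :=
  ∀ x ∈ I, ∀ y ∈ I, x * y = 0

end AlgIdeal

section

variable (F : Type v) (A : Type u) [Field F] [NonUnitalNonAssocRing A] [Module F A]

/-- The Lie-solvable powers of `A`: the first one is `A`, and the next one is the subspace
spanned by all commutators `x y - y x` of elements of the preceding one. -/
def lieSolvablePower : ℕ → Submodule F A
  | 0 => ⊤
  | n + 1 => Submodule.span F
      {c | ∃ x ∈ lieSolvablePower n, ∃ y ∈ lieSolvablePower n, c = x * y - y * x}

/-- `A` is *Lie-solvable* if some Lie-solvable power of `A` vanishes. -/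
def IsLieSolvableAlg : Prop := ∃ n : ℕ, lieSolvablePower F A n = ⊥

/-- An *integral domain* is an associative and commutative (not necessarily unital) algebra with
no nonzero zero divisors. -/
structure IsIntegralDomainAlg (A : Type u) [NonUnitalNonAssocRing A] : Prop where
  mul_assoc : ∀ x y z : A, (x * y) * z = x * (y * z)
  mul_comm : ∀ x y : A, x * y = y * x
  eq_zero_or_eq_zero : ∀ x y : A, x * y = 0 → x = 0 ∨ y = 0

variable [IsScalarTower F A A] [SMulCommClass F A A]

/-- The sum of all trivial ideals of `A`. -/
def sumTrivialIdeals : AlgIdeal F A := AlgIdeal.sum {I | I.IsTrivial}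

/-- The transfinite Baer series of `A`. It starts with `0`; the member at `α + 1` is the preimage
in `A` of the sum of all trivial ideals of the quotient of `A` by the member at `α`; the member at
a limit ordinal is the sum (equivalently the union, see `coe_baerSeries_limit`) of all the
preceding ones. -/
noncomputable def baerSeries (α : Ordinal.{u}) : AlgIdeal F A :=
  Ordinal.limitRecOn α (AlgIdeal.zero F A)
    (fun _ B => B.preimage (sumTrivialIdeals F B.Quotient))
    (fun α _ B => AlgIdeal.sum {I | ∃ (β : Ordinal.{u}) (hβ : β < α), I = B β hβ})

/-- The *Baer radical* of `A`: the member of the Baer series at an ordinal of cardinality greater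
than that of `A` (by `baerSeries_eq_baerRadical`, the choice of this ordinal is irrelevant). -/
noncomputable def baerRadical : AlgIdeal F A :=
  baerSeries F A (Order.succ (Cardinal.mk A)).ord

theorem baerSeries_zero : baerSeries F A 0 = AlgIdeal.zero F A :=
  Ordinal.limitRecOn_zero ..

theorem baerSeries_succ (α : Ordinal.{u}) : baerSeries F A (α + 1) =
    (baerSeries F A α).preimage (sumTrivialIdeals F (baerSeries F A α).Quotient) :=
  Ordinal.limitRecOn_add_one ..

theorem baerSeries_limit {α : Ordinal.{u}} (hα : Order.IsSuccLimit α) : baerSeries F A α =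
    AlgIdeal.sum {I | ∃ (β : Ordinal.{u}) (_ : β < α), I = baerSeries F A β} :=
  Ordinal.limitRecOn_limit _ _ _ _ hα

theorem baerSeries_le_succ (α : Ordinal.{u}) :
    baerSeries F A α ≤ baerSeries F A (α + 1) := by
  rw [baerSeries_succ]
  intro x hx
  rw [AlgIdeal.mem_preimage, (AlgIdeal.proj_eq_zero _ x).2 hx]
  exact Submodule.zero_mem _

theorem baerSeries_mono : Monotone (baerSeries F A) := by
  intro β α
  induction α using Ordinal.limitRecOn with
  | zero =>
    intro h
    rw [nonpos_iff_eq_zero.1 h]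
  | add_one α ih =>
    intro h
    rcases h.lt_or_eq with h | h
    · exact (ih (Order.lt_add_one_iff.1 h)).trans (baerSeries_le_succ F A α)
    · rw [h]
  | limit α hα ih =>
    intro h
    rcases h.lt_or_eq with h | h
    · rw [baerSeries_limit F A hα]
      exact AlgIdeal.le_sum ⟨β, h, rfl⟩
    · rw [h]

theorem coe_baerSeries_limit {α : Ordinal.{u}} (hα : Order.IsSuccLimit α) :
    (baerSeries F A α : Set A) = ⋃ β : Set.Iio α, (baerSeries F A β : Set A) := by
  apply Set.Subset.antisymm
  · intro x hx
    have : Nonempty (Set.Iio α) := ⟨⟨0, pos_iff_ne_zero.2 hα.ne_bot⟩⟩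
    have hd : Directed (· ≤ ·) fun β : Set.Iio α => (baerSeries F A β).toSubmodule :=
      Monotone.directed_le fun β γ h => baerSeries_mono F A h
    rw [baerSeries_limit F A hα] at hx
    have hle : (AlgIdeal.sum {I | ∃ (β : Ordinal.{u}) (_ : β < α), I = baerSeries F A β}).toSubmodule
        ≤ ⨆ β : Set.Iio α, (baerSeries F A β).toSubmodule := by
      refine iSup₂_le ?_
      rintro _ ⟨β, hβ, rfl⟩
      exact le_iSup (fun β : Set.Iio α => (baerSeries F A β).toSubmodule) ⟨β, hβ⟩
    obtain ⟨β, hβ⟩ := (Submodule.mem_iSup_of_directed _ hd).1 (hle hx)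
    exact Set.mem_iUnion.2 ⟨β, hβ⟩
  · exact Set.iUnion_subset fun β => baerSeries_mono F A (le_of_lt β.2)

theorem baerSeries_eq_of_succ_eq {α : Ordinal.{u}}
    (h : baerSeries F A (α + 1) = baerSeries F A α) {δ : Ordinal.{u}} (hδ : α ≤ δ) :
    baerSeries F A δ = baerSeries F A α := by
  induction δ using Ordinal.limitRecOn with
  | zero => rw [nonpos_iff_eq_zero.1 hδ]
  | add_one δ ih =>
    rcases hδ.lt_or_eq with h' | h'
    · rw [baerSeries_succ, ih (Order.lt_add_one_iff.1 h'), ← baerSeries_succ, h]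
    · rw [h']
  | limit δ hlim ih =>
    refine le_antisymm ?_ (baerSeries_mono F A hδ)
    change (baerSeries F A δ : Set A) ⊆ _
    rw [coe_baerSeries_limit F A hlim]
    refine Set.iUnion_subset fun β => ?_
    rcases le_total α β with h' | h'
    · exact (ih β β.2 h').le
    · exact baerSeries_mono F A h'

theorem exists_baerSeries_succ_eq {δ : Ordinal.{u}} (hδ : Cardinal.mk A < δ.card) :
    ∃ α < δ, baerSeries F A (α + 1) = baerSeries F A α := by
  by_contra! hne
  have hex : ∀ α : Set.Iio δ, ∃ x, x ∈ baerSeries F A (α.1 + 1) ∧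
      x ∉ baerSeries F A α.1 := by
    intro α
    by_contra! hx
    exact hne α.1 α.2 (le_antisymm hx (baerSeries_le_succ F A α.1))
  choose f hf hf' using hex
  have key : ∀ α β : Set.Iio δ, α.1 < β.1 → f α ≠ f β := fun α β h he =>
    hf' β (he ▸ baerSeries_mono F A (Order.add_one_le_of_lt h) (hf α))
  have hinj : Function.Injective f := by
    intro α β he
    rcases lt_trichotomy α.1 β.1 with h | h | h
    · exact (key α β h he).elim
    · exact Subtype.ext h
    · exact (key β α h he.symm).elim
  have h := Cardinal.lift_mk_le_lift_mk_of_injective hinj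
  rw [Cardinal.mk_Iio_ordinal, Cardinal.lift_lift, Cardinal.lift_le] at h
  exact absurd hδ (not_lt.2 h)

/-- The Baer series is constant from any ordinal of cardinality greater than that of `A` on. -/
theorem baerSeries_eq_baerRadical {δ : Ordinal.{u}} (hδ : Cardinal.mk A < δ.card) :
    baerSeries F A δ = baerRadical F A := by
  have hδ' : (Order.succ (Cardinal.mk A)).ord ≤ δ :=
    Cardinal.ord_le.2 (Order.succ_le_of_lt hδ)
  obtain ⟨α, hα, h⟩ := exists_baerSeries_succ_eq F A
    (δ := (Order.succ (Cardinal.mk A)).ord) (by simp)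
  rw [baerRadical, baerSeries_eq_of_succ_eq F A h hα.le,
    baerSeries_eq_of_succ_eq F A h (hα.le.trans hδ')]

end

section NovikovIdentities

variable {A : Type u} [NonUnitalNonAssocRing A] [IsNovikov A]

theorem IsNovikov.left_symm (x y z : A) :
    (x * y) * z - x * (y * z) = (y * x) * z - y * (x * z) :=
  IsNovikov.associator_left_symm x y z

/-- Twice `[a, b] c` is `[a c, b] + [a, b c]`. -/
theorem IsNovikov.commutator_mul_add_self (a b c : A) :
    (a * b - b * a) * c + (a * b - b * a) * c =
      ((a * c) * b - b * (a * c)) + (a * (b * c) - (b * c) * a) := by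
  have h := IsNovikov.left_symm a b c
  have h₁ := IsNovikov.mul_right_comm a b c
  have h₂ := IsNovikov.mul_right_comm b a c
  simp only [sub_mul]
  grind

/-- The Jacobi identity, in Leibniz form. -/
theorem IsNovikov.jacobi (x y a : A) :
    (x * y - y * x) * a - a * (x * y - y * x) =
      ((x * a - a * x) * y - y * (x * a - a * x)) +
        (x * (y * a - a * y) - (y * a - a * y) * x) := by
  have h₁ := IsNovikov.left_symm x y a
  have h₂ := IsNovikov.left_symm x a y
  have h₃ := IsNovikov.left_symm a y x
  simp only [sub_mul, mul_sub]
  grind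

/-- Left multiplication of a product, which shows that products of ideals absorb it. -/
theorem IsNovikov.left_mul_mul (a x y : A) :
    a * (x * y) = (a * x) * y - (x * a) * y + x * (a * y) := by
  have h := IsNovikov.left_symm a x y
  grind

/-- A commutative Novikov algebra is associative. -/
theorem IsNovikov.mul_assoc_of_mul_comm (hc : ∀ x y : A, x * y = y * x) (x y z : A) :
    (x * y) * z = x * (y * z) := by
  rw [hc x y, IsNovikov.mul_right_comm, hc (y * z)]

end NovikovIdentities

namespace AlgIdeal

section Basic

variable {F : Type v} {A : Type u} [Field F] [NonUnitalNonAssocRing A] [Module F A]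

theorem mem_of_add_self_mem (hF : ringChar F ≠ 2) (I : Submodule F A) {x : A} (h : x + x ∈ I) :
    x ∈ I := by
  have h2 : (2 : F) ≠ 0 := Ring.two_ne_zero hF
  rw [← two_smul F] at h
  exact (I.smul_mem_iff h2).1 h

theorem eq_zero_of_add_self (F : Type v) [Field F] [Module F A] (hF : ringChar F ≠ 2) {x : A}
    (h : x + x = 0) : x = 0 :=
  (Submodule.mem_bot F).1 (mem_of_add_self_mem hF ⊥ ((Submodule.mem_bot F).2 h))

/-- The whole algebra, as an ideal. -/
def whole (F : Type v) (A : Type u) [Field F] [NonUnitalNonAssocRing A] [Module F A] :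
    AlgIdeal F A where
  toSubmodule := ⊤
  mul_mem_left' _ _ _ := trivial
  mul_mem_right' _ _ _ := trivial

instance instIsNovikovQuotient [IsNovikov A] (I : AlgIdeal F A) : IsNovikov I.Quotient where
  associator_left_symm x y z := by
    obtain ⟨x, rfl⟩ := I.proj_surjective x
    obtain ⟨y, rfl⟩ := I.proj_surjective y
    obtain ⟨z, rfl⟩ := I.proj_surjective z
    simp only [associator_apply, ← proj_mul, ← map_sub, IsNovikov.left_symm x y z]
  mul_right_comm x y z := by
    obtain ⟨x, rfl⟩ := I.proj_surjective x
    obtain ⟨y, rfl⟩ := I.proj_surjective y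
    obtain ⟨z, rfl⟩ := I.proj_surjective z
    simp only [← proj_mul, IsNovikov.mul_right_comm x y z]

theorem lieSolvablePower_quotient_le (I : AlgIdeal F A) (n : ℕ) :
    lieSolvablePower F I.Quotient n ≤ (lieSolvablePower F A n).map I.proj := by
  induction n with
  | zero =>
    intro x _
    obtain ⟨a, rfl⟩ := I.proj_surjective x
    exact ⟨a, trivial, rfl⟩
  | succ n ih =>
    refine Submodule.span_le.2 ?_
    rintro _ ⟨x, hx, y, hy, rfl⟩
    obtain ⟨a, ha, rfl⟩ := ih hx
    obtain ⟨b, hb, rfl⟩ := ih hy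
    exact ⟨a * b - b * a, Submodule.subset_span ⟨a, ha, b, hb, rfl⟩, by
      rw [map_sub, proj_mul, proj_mul]⟩

theorem isLieSolvableAlg_quotient (h : IsLieSolvableAlg F A) (I : AlgIdeal F A) :
    IsLieSolvableAlg F I.Quotient := by
  obtain ⟨n, hn⟩ := h
  refine ⟨n, eq_bot_iff.2 ?_⟩
  have := lieSolvablePower_quotient_le I n
  rwa [hn, Submodule.map_bot] at this

theorem isIntegralDomainAlg_quotient {I : AlgIdeal F A}
    (hassoc : ∀ x y z : A, (x * y) * z - x * (y * z) ∈ I)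
    (hcomm : ∀ x y : A, x * y - y * x ∈ I)
    (hprime : ∀ x y : A, x * y ∈ I → x ∈ I ∨ y ∈ I) : IsIntegralDomainAlg I.Quotient where
  mul_assoc x y z := by
    obtain ⟨x, rfl⟩ := I.proj_surjective x
    obtain ⟨y, rfl⟩ := I.proj_surjective y
    obtain ⟨z, rfl⟩ := I.proj_surjective z
    rw [← sub_eq_zero]
    simpa only [← proj_mul, ← map_sub, proj_eq_zero] using hassoc x y z
  mul_comm x y := by
    obtain ⟨x, rfl⟩ := I.proj_surjective x
    obtain ⟨y, rfl⟩ := I.proj_surjective y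
    rw [← sub_eq_zero]
    simpa only [← proj_mul, ← map_sub, proj_eq_zero] using hcomm x y
  eq_zero_or_eq_zero x y := by
    obtain ⟨x, rfl⟩ := I.proj_surjective x
    obtain ⟨y, rfl⟩ := I.proj_surjective y
    simpa only [← proj_mul, proj_eq_zero] using hprime x y

/-- An algebra is *semiprime* if it has no nonzero trivial ideals. -/
def IsSemiprime (F : Type v) (A : Type u) [Field F] [NonUnitalNonAssocRing A] [Module F A] :
    Prop :=
  ∀ I : AlgIdeal F A, I.IsTrivial → ∀ x ∈ I, x = 0

/-- The iterated squares of an element. -/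
def iterSquare (x : A) : ℕ → A
  | 0 => x
  | n + 1 => iterSquare x n * iterSquare x n

theorem iterSquare_mem_of_le (I : AlgIdeal F A) {x : A} {m n : ℕ} (h : m ≤ n)
    (hm : iterSquare x m ∈ I) : iterSquare x n ∈ I := by
  induction h with
  | refl => exact hm
  | step _ ih => exact I.mul_mem_left _ ih

end Basic

section Products

variable {F : Type v} {A : Type u} [Field F] [NonUnitalNonAssocRing A] [Module F A]
  [IsScalarTower F A A] [SMulCommClass F A A]

/-- A subspace spanned by a set whose left and right multiples lie in the subspace. -/
def ofSpan (s : Set A) (hl : ∀ a, ∀ x ∈ s, a * x ∈ Submodule.span F s)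
    (hr : ∀ a, ∀ x ∈ s, x * a ∈ Submodule.span F s) : AlgIdeal F A where
  toSubmodule := Submodule.span F s
  mul_mem_left' a _ hx :=
    (Submodule.span_le.2 (hl a) :
      Submodule.span F s ≤ (Submodule.span F s).comap (LinearMap.mulLeft F a)) hx
  mul_mem_right' a _ hx :=
    (Submodule.span_le.2 (hr a) :
      Submodule.span F s ≤ (Submodule.span F s).comap (LinearMap.mulRight F a)) hx

variable [IsNovikov A]

/-- The product of two ideals of a Novikov algebra. -/
def product (I J : AlgIdeal F A) : AlgIdeal F A :=
  ofSpan {p | ∃ x ∈ I, ∃ y ∈ J, p = x * y}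
    (by
      rintro a _ ⟨x, hx, y, hy, rfl⟩
      rw [IsNovikov.left_mul_mul]
      exact add_mem (sub_mem
        (Submodule.subset_span ⟨_, I.mul_mem_left a hx, y, hy, rfl⟩)
        (Submodule.subset_span ⟨_, I.mul_mem_right a hx, y, hy, rfl⟩))
        (Submodule.subset_span ⟨x, hx, _, J.mul_mem_left a hy, rfl⟩))
    (by
      rintro a _ ⟨x, hx, y, hy, rfl⟩
      rw [IsNovikov.mul_right_comm]
      exact Submodule.subset_span ⟨_, I.mul_mem_right a hx, y, hy, rfl⟩)

/-- The subspace spanned by the commutators of elements of two ideals of a Novikov algebra is an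
ideal. -/
def commutator (hF : ringChar F ≠ 2) (I J : AlgIdeal F A) : AlgIdeal F A :=
  have hr : ∀ (a : A), ∀ c ∈ {c : A | ∃ x ∈ I, ∃ y ∈ J, c = x * y - y * x},
      c * a ∈ Submodule.span F {c : A | ∃ x ∈ I, ∃ y ∈ J, c = x * y - y * x} := by
    rintro a _ ⟨x, hx, y, hy, rfl⟩
    refine mem_of_add_self_mem hF _ ?_
    rw [IsNovikov.commutator_mul_add_self]
    exact add_mem (Submodule.subset_span ⟨_, I.mul_mem_right a hx, y, hy, rfl⟩)
      (Submodule.subset_span ⟨x, hx, _, J.mul_mem_right a hy, rfl⟩)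
  ofSpan {c | ∃ x ∈ I, ∃ y ∈ J, c = x * y - y * x}
    (by
      rintro a _ ⟨x, hx, y, hy, rfl⟩
      rw [← sub_sub_self ((x * y - y * x) * a) (a * (x * y - y * x)), IsNovikov.jacobi]
      refine sub_mem (hr a _ ⟨x, hx, y, hy, rfl⟩) (add_mem
        (Submodule.subset_span ⟨_, ?_, y, hy, rfl⟩) (Submodule.subset_span ⟨x, hx, _, ?_, rfl⟩))
      · exact I.toSubmodule.sub_mem (I.mul_mem_right a hx) (I.mul_mem_left a hx)
      · exact J.toSubmodule.sub_mem (J.mul_mem_right a hy) (J.mul_mem_left a hy))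
    hr

theorem commutator_induction (hF : ringChar F ≠ 2) {I J : AlgIdeal F A} {S : Submodule F A}
    (h : ∀ x ∈ I, ∀ y ∈ J, x * y - y * x ∈ S) {c : A} (hc : c ∈ commutator hF I J) : c ∈ S :=
  (Submodule.span_le.2 (by rintro _ ⟨x, hx, y, hy, rfl⟩; exact h x hx y hy) :
    (commutator hF I J).toSubmodule ≤ S) hc

theorem mem_commutator (hF : ringChar F ≠ 2) {I J : AlgIdeal F A} {x y : A} (hx : x ∈ I)
    (hy : y ∈ J) : x * y - y * x ∈ commutator hF I J :=
  Submodule.subset_span ⟨x, hx, y, hy, rfl⟩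

theorem exists_eq_lieSolvablePower (hF : ringChar F ≠ 2) (n : ℕ) :
    ∃ I : AlgIdeal F A, I.toSubmodule = lieSolvablePower F A n := by
  induction n with
  | zero => exact ⟨whole F A, rfl⟩
  | succ n ih =>
    obtain ⟨I, hI⟩ := ih
    refine ⟨commutator hF I I, ?_⟩
    rw [lieSolvablePower, ← hI]
    rfl

/-- In a semiprime Novikov algebra an ideal `K` with `(K K) K = 0` is zero. -/
theorem IsSemiprime.eq_zero_of_mul_mul (hA : IsSemiprime F A) {K : AlgIdeal F A}
    (hK : ∀ x ∈ K, ∀ y ∈ K, ∀ z ∈ K, (x * y) * z = 0) {x : A} (hx : x ∈ K) : x = 0 := by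
  refine hA K (fun x hx y hy => ?_) x hx
  refine hA (K.product K) (fun p hp q hq => ?_) _ (Submodule.subset_span ⟨x, hx, y, hy, rfl⟩)
  have hq' : q ∈ K := (Submodule.span_le.2 (by
    rintro _ ⟨x, hx, y, _, rfl⟩
    exact K.mul_mem_right y hx) : (K.product K).toSubmodule ≤ K.toSubmodule) hq
  exact (Submodule.span_le.2 (by
    rintro _ ⟨x, hx, y, hy, rfl⟩
    exact hK x hx y hy q hq') :
      (K.product K).toSubmodule ≤ LinearMap.ker (LinearMap.mulRight F q)) hp

/-- A commutative ideal of a semiprime Novikov algebra is central. -/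
theorem IsSemiprime.mul_comm_of_commutative (hF : ringChar F ≠ 2) (hA : IsSemiprime F A)
    {I : AlgIdeal F A} (hI : ∀ x ∈ I, ∀ y ∈ I, x * y = y * x) (a : A) {x : A} (hx : x ∈ I) :
    a * x = x * a := by
  have hdouble : ∀ a : A, ∀ i ∈ I, ∀ j ∈ I,
      a * (i * j) - (i * j) * a = (a * i - i * a) * j + (a * i - i * a) * j := by
    intro a i hi j hj
    have h₁ := IsNovikov.left_symm a i j
    have h₂ := IsNovikov.mul_right_comm a i j
    have h₃ := IsNovikov.mul_right_comm i a j
    have h₄ := hI i hi (a * j) (I.mul_mem_left a hj)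
    simp only [sub_mul]
    grind
  have hassoc : ∀ i ∈ I, ∀ j ∈ I, ∀ k ∈ I, (i * j) * k = i * (j * k) := by
    intro i hi j hj k hk
    rw [hI i hi j hj, IsNovikov.mul_right_comm, hI _ (I.mul_mem_right k hj) _ hi]
  have hann : ∀ a : A, ∀ i ∈ I, ∀ j ∈ I, ∀ k ∈ I, ((a * i - i * a) * j) * k = 0 := by
    intro a i hi j hj k hk
    have h₁ := hdouble a (i * j) (I.mul_mem_right j hi) k hk
    have h₂ := hdouble a i hi (j * k) (I.mul_mem_right k hj)
    have hc : a * i - i * a ∈ I :=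
      I.toSubmodule.sub_mem (I.mul_mem_left a hi) (I.mul_mem_right a hi)
    rw [hdouble a i hi j hj, hassoc i hi j hj k hk, h₂, add_mul,
      hassoc _ hc j hj k hk] at h₁
    rw [hassoc _ hc j hj k hk]
    refine eq_zero_of_add_self F hF ?_
    grind
  have hle : ∀ c ∈ commutator hF (whole F A) I, c ∈ I := fun c hc =>
    commutator_induction hF (S := I.toSubmodule)
      (fun a _ i hi => I.toSubmodule.sub_mem (I.mul_mem_left a hi) (I.mul_mem_right a hi)) hc
  refine sub_eq_zero.1 (hA.eq_zero_of_mul_mul (K := commutator hF (whole F A) I)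
    (fun c hc j hj k hk => ?_) (mem_commutator hF trivial hx))
  exact commutator_induction hF
    (S := LinearMap.ker ((LinearMap.mulRight F k).comp (LinearMap.mulRight F j)))
    (fun a _ i hi => hann a i hi j (hle j hj) k (hle k hk)) hc

/-- In a semiprime Novikov algebra an ideal whose commutators commute with each other is
commutative. -/
theorem IsSemiprime.mul_comm_of_metabelian (hF : ringChar F ≠ 2) (hA : IsSemiprime F A)
    {J : AlgIdeal F A}
    (hJ : ∀ x ∈ commutator hF J J, ∀ y ∈ commutator hF J J, x * y = y * x) {a b : A}
    (ha : a ∈ J) (hb : b ∈ J) : a * b = b * a := by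
  refine sub_eq_zero.1 (hA (commutator hF J J) (fun c hc i hi => ?_) _ (mem_commutator hF ha hb))
  refine commutator_induction hF (S := LinearMap.ker (LinearMap.mulRight F i))
    (fun a _ b _ => ?_) hc
  change (a * b - b * a) * i = 0
  rw [sub_mul, IsNovikov.mul_right_comm a, IsNovikov.mul_right_comm b,
    hA.mul_comm_of_commutative hF hJ a hi, hA.mul_comm_of_commutative hF hJ b hi,
    IsNovikov.mul_right_comm, sub_self]

/-- A semiprime Lie-solvable Novikov algebra is commutative. -/
theorem IsSemiprime.mul_comm (hF : ringChar F ≠ 2) (hA : IsSemiprime F A)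
    (hs : IsLieSolvableAlg F A) (x y : A) : x * y = y * x := by
  have hstep : ∀ n, lieSolvablePower F A n = ⊥ → lieSolvablePower F A 1 = ⊥ := by
    intro n
    induction n with
    | zero =>
      intro h
      refine eq_bot_iff.2 (le_top.trans_eq h)
    | succ n ih =>
      intro h
      cases n with
      | zero => exact h
      | succ n =>
        refine ih ?_
        obtain ⟨J, hJ⟩ := exists_eq_lieSolvablePower (F := F) (A := A) hF n
        have hJ' : (commutator hF J J).toSubmodule = lieSolvablePower F A (n + 1) := by
          rw [lieSolvablePower, ← hJ]
          rfl
        refine eq_bot_iff.2 (Submodule.span_le.2 ?_)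
        rw [← hJ]
        rintro _ ⟨a, ha, b, hb, rfl⟩
        refine sub_eq_zero.2 (hA.mul_comm_of_metabelian hF (J := J) (fun c hc d hd => ?_) ha hb)
        refine sub_eq_zero.1 ((Submodule.mem_bot F).1 (h ▸ Submodule.subset_span ⟨c, ?_, d, ?_, rfl⟩))
        · rw [← hJ']; exact hc
        · rw [← hJ']; exact hd
  obtain ⟨n, hn⟩ := hs
  exact sub_eq_zero.1 ((Submodule.mem_bot F).1
    (hstep n hn ▸ Submodule.subset_span ⟨x, trivial, y, trivial, rfl⟩))

end Products

section Commutative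

variable {F : Type v} {A : Type u} [Field F] [NonUnitalNonAssocRing A] [Module F A]
  [IsScalarTower F A A]

/-- The ideal quotient `(P : y)` in a commutative associative algebra. -/
def colon (hc : ∀ x y : A, x * y = y * x) (ha : ∀ x y z : A, (x * y) * z = x * (y * z))
    (P : AlgIdeal F A) (y : A) : AlgIdeal F A where
  toSubmodule :=
    { carrier := {w | w * y ∈ P}
      add_mem' := fun {a b} h₁ h₂ => by
        have h : a * y + b * y ∈ P := P.toSubmodule.add_mem h₁ h₂
        rwa [← add_mul] at h
      zero_mem' := by
        change 0 * y ∈ P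
        rw [zero_mul]
        exact P.toSubmodule.zero_mem
      smul_mem' := fun c w h => by
        change (c • w) * y ∈ P
        rw [smul_mul_assoc]
        exact P.toSubmodule.smul_mem c h }
  mul_mem_left' a x hx := by
    change (a * x) * y ∈ P
    rw [ha]
    exact P.mul_mem_left a hx
  mul_mem_right' a x hx := by
    change (x * a) * y ∈ P
    rw [hc x a, ha]
    exact P.mul_mem_left a hx

theorem le_colon (hc : ∀ x y : A, x * y = y * x)
    (ha : ∀ x y z : A, (x * y) * z = x * (y * z)) (P : AlgIdeal F A) (y : A) :
    P ≤ P.colon hc ha y := fun _ hx => P.mul_mem_right y hx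

/-- A semiprime commutative associative algebra is reduced. -/
theorem IsSemiprime.eq_zero_of_mul_self (hA : IsSemiprime F A) (hc : ∀ x y : A, x * y = y * x)
    (ha : ∀ x y z : A, (x * y) * z = x * (y * z)) {x : A} (hx : x * x = 0) : x = 0 := by
  have hann : ∀ w : A, (∀ a, w * a = 0) → w = 0 := by
    intro w hw
    refine hA
      { toSubmodule :=
          { carrier := {w | ∀ a, w * a = 0}
            add_mem' := fun {a b} h₁ h₂ c => by rw [add_mul, h₁, h₂, add_zero]
            zero_mem' := fun a => zero_mul a
            smul_mem' := fun c w h a => by rw [smul_mul_assoc, h, smul_zero] }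
        mul_mem_left' := fun a w h b => by rw [hc a, ha, h]
        mul_mem_right' := fun a w h b => by rw [ha, h] } (fun u hu v _ => hu v) w hw
  refine hann x fun a => ?_
  rw [hc]
  refine hA
    { toSubmodule := LinearMap.range (LinearMap.mulRight F x)
      mul_mem_left' := ?_
      mul_mem_right' := ?_ } ?_ _ ⟨a, rfl⟩
  · rintro b _ ⟨c, rfl⟩
    exact ⟨b * c, ha b c x⟩
  · rintro b _ ⟨c, rfl⟩
    refine ⟨b * c, ?_⟩
    change (b * c) * x = (c * x) * b
    rw [ha, hc b]
  · rintro _ ⟨b, rfl⟩ _ ⟨c, rfl⟩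
    change (b * x) * (c * x) = 0
    rw [hc c x, ha, ← ha x x c, hx, zero_mul, mul_zero]

/-- The union of a nonempty chain of ideals. -/
def chainUnion (c : Set (AlgIdeal F A)) (hc : IsChain (· ≤ ·) c) (hne : c.Nonempty) :
    AlgIdeal F A where
  carrier := {x | ∃ I ∈ c, x ∈ I}
  add_mem' := by
    rintro x y ⟨I, hI, hx⟩ ⟨J, hJ, hy⟩
    rcases hc.total hI hJ with h | h
    · exact ⟨J, hJ, J.toSubmodule.add_mem (h hx) hy⟩
    · exact ⟨I, hI, I.toSubmodule.add_mem hx (h hy)⟩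
  zero_mem' := hne.imp fun I hI => ⟨hI, I.toSubmodule.zero_mem⟩
  smul_mem' := by
    rintro a x ⟨I, hI, hx⟩
    exact ⟨I, hI, I.toSubmodule.smul_mem a hx⟩
  mul_mem_left' := by
    rintro a x ⟨I, hI, hx⟩
    exact ⟨I, hI, I.mul_mem_left a hx⟩
  mul_mem_right' := by
    rintro a x ⟨I, hI, hx⟩
    exact ⟨I, hI, I.mul_mem_right a hx⟩

/-- A nonzero element of a semiprime commutative associative algebra is avoided by a prime
ideal. -/
theorem IsSemiprime.exists_prime_notMem (hA : IsSemiprime F A) (hc : ∀ x y : A, x * y = y * x)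
    (ha : ∀ x y z : A, (x * y) * z = x * (y * z)) {x : A} (hx : x ≠ 0) :
    ∃ P : AlgIdeal F A, x ∉ P ∧ ∀ y z : A, y * z ∈ P → y ∈ P ∨ z ∈ P := by
  have hsq : ∀ n, iterSquare x n ≠ 0 := by
    intro n
    induction n with
    | zero => exact hx
    | succ n ih => exact fun h => ih (hA.eq_zero_of_mul_self hc ha h)
  obtain ⟨P, -, hP⟩ := zorn_le_nonempty₀ {P : AlgIdeal F A | ∀ n, iterSquare x n ∉ P}
    (fun c hcs hchain I hI => ⟨chainUnion c hchain ⟨I, hI⟩,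
      fun n ⟨J, hJ, hn⟩ => hcs hJ n hn, fun J hJ y hy => ⟨J, hJ, hy⟩⟩)
    (zero F A) (fun n h => hsq n h)
  have hmeet : ∀ Q : AlgIdeal F A, P ≤ Q → ∀ y ∈ Q, y ∉ P → ∃ n, iterSquare x n ∈ Q := by
    intro Q hPQ y hyQ hyP
    by_contra! h
    exact hyP (hP.2 h hPQ hyQ)
  refine ⟨P, hP.1 0, fun y z hyz => ?_⟩
  by_contra! hn
  obtain ⟨m, hm⟩ := hmeet _ (P.le_colon hc ha z) y hyz hn.1
  have hm' : z * iterSquare x m ∈ P := by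
    rw [hc]
    exact hm
  obtain ⟨n, hn⟩ := hmeet _ (P.le_colon hc ha (iterSquare x m)) z hm' hn.2
  have h₁ : iterSquare x (max m n) * iterSquare x m ∈ P :=
    iterSquare_mem_of_le (P.colon hc ha (iterSquare x m)) (le_max_right m n) hn
  rw [hc] at h₁
  exact hP.1 (max m n + 1)
    (iterSquare_mem_of_le (P.colon hc ha (iterSquare x (max m n))) (le_max_left m n) h₁)

end Commutative

end AlgIdeal

section BaerRadical

variable (F : Type v) (A : Type u) [Field F] [NonUnitalNonAssocRing A] [Module F A]
  [IsScalarTower F A A] [SMulCommClass F A A]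

/-- The quotient by the Baer radical is semiprime. -/
theorem isSemiprime_quotient_baerRadical :
    AlgIdeal.IsSemiprime F (baerRadical F A).Quotient := by
  intro J hJ x hx
  obtain ⟨α, hα, h⟩ := exists_baerSeries_succ_eq F A
    (δ := (Order.succ (Cardinal.mk A)).ord) (by simp)
  have hsucc : baerSeries F A ((Order.succ (Cardinal.mk A)).ord + 1) = baerRadical F A := by
    rw [baerRadical, baerSeries_eq_of_succ_eq F A h hα.le, baerSeries_eq_of_succ_eq F A h
      (hα.le.trans (Order.lt_add_one_iff.2 le_rfl).le)]
  obtain ⟨a, rfl⟩ := (baerRadical F A).proj_surjective x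
  rw [AlgIdeal.proj_eq_zero, ← hsucc, baerSeries_succ, AlgIdeal.mem_preimage]
  exact AlgIdeal.le_sum (S := {I | I.IsTrivial}) hJ hx

variable {F A}

/-- Every member of the Baer series lies in each ideal whose quotient is an integral domain. -/
theorem baerSeries_le_of_isIntegralDomainAlg {I : AlgIdeal F A}
    (hI : IsIntegralDomainAlg I.Quotient) (α : Ordinal.{u}) : baerSeries F A α ≤ I := by
  induction α using Ordinal.limitRecOn with
  | zero =>
    rw [baerSeries_zero]
    intro x hx
    have hx : x = 0 := hx
    rw [hx]
    exact I.toSubmodule.zero_mem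
  | add_one α ih =>
    rw [baerSeries_succ]
    intro x hx
    have hle : (sumTrivialIdeals F (baerSeries F A α).Quotient).toSubmodule ≤
        I.toSubmodule.map (baerSeries F A α).proj := by
      refine iSup₂_le fun J hJ y hy => ?_
      obtain ⟨a, rfl⟩ := (baerSeries F A α).proj_surjective y
      refine ⟨a, ?_, rfl⟩
      have haa : a * a ∈ I := by
        refine ih ?_
        rw [← AlgIdeal.proj_eq_zero, AlgIdeal.proj_mul]
        exact hJ _ hy _ hy
      rw [← AlgIdeal.proj_eq_zero, AlgIdeal.proj_mul] at haa
      exact (AlgIdeal.proj_eq_zero I a).1 (or_self_iff.1 (hI.eq_zero_or_eq_zero _ _ haa))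
    obtain ⟨a, ha, hax⟩ := hle hx
    have hsub : x - a ∈ I := by
      refine ih ?_
      rw [← AlgIdeal.proj_eq_zero, map_sub, hax, sub_self]
    have h : x - a + a ∈ I := I.toSubmodule.add_mem hsub ha
    rwa [sub_add_cancel] at h
  | limit α hα ih =>
    rw [baerSeries_limit F A hα]
    have hle : (AlgIdeal.sum {I | ∃ (β : Ordinal.{u}) (_ : β < α),
        I = baerSeries F A β}).toSubmodule ≤ I.toSubmodule := by
      refine iSup₂_le ?_
      rintro _ ⟨β, hβ, rfl⟩
      exact ih β hβ
    exact hle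

end BaerRadical

/-- In a Lie-solvable Novikov algebra `A` over a field of characteristic different from `2`, the
Baer radical is the intersection of all ideals `I` such that `A / I` is an integral domain. -/
theorem corollary1 (F : Type v) (A : Type u) [Field F] (hF : ringChar F ≠ 2)
    [NonUnitalNonAssocRing A] [Module F A] [IsScalarTower F A A] [SMulCommClass F A A]
    [IsNovikov A] (hA : IsLieSolvableAlg F A) :
    (baerRadical F A : Set A) =
      ⋂ (I : AlgIdeal F A) (_ : IsIntegralDomainAlg I.Quotient), (I : Set A) := by
  refine Set.Subset.antisymm
    (Set.subset_iInter₂ fun I hI => baerSeries_le_of_isIntegralDomainAlg hI _) fun x hx => ?_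
  by_contra hxB
  set B := baerRadical F A
  have hB : AlgIdeal.IsSemiprime F B.Quotient := isSemiprime_quotient_baerRadical F A
  have hc := hB.mul_comm hF (AlgIdeal.isLieSolvableAlg_quotient hA B)
  have ha := IsNovikov.mul_assoc_of_mul_comm hc
  obtain ⟨P, hxP, hP⟩ := hB.exists_prime_notMem hc ha
    (mt (AlgIdeal.proj_eq_zero B x).1 hxB)
  refine hxP (Set.mem_iInter₂.1 hx (B.preimage P) (AlgIdeal.isIntegralDomainAlg_quotient
    (fun a b c => ?_) (fun a b => ?_) (fun a b => hP (B.proj a) (B.proj b))))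
  · rw [AlgIdeal.mem_preimage]
    simp only [map_sub, AlgIdeal.proj_mul, ha, sub_self]
    exact P.toSubmodule.zero_mem
  · rw [AlgIdeal.mem_preimage, map_sub, AlgIdeal.proj_mul, AlgIdeal.proj_mul, hc, sub_self]
    exact P.toSubmodule.zero_mem
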